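/- Let $n\ge 2$, $p>1$, let $D\subset\mathbb R^n$ be a domain and let $m$ be Lebesgue measure. Curves. A curve is a continuous map $\gamma$ of an interval $I\subset\mathbb R$ (of any kind) into $\mathbb R^n$; it is locally rectifiable if each closed subcurve $\gamma|_{[a,b]}$, $[a,b]\subset I$, has finite length. The normal representation $\alpha^0:[0,l(\alpha)]\to\mathbb R^n$ of a closed rectifiable curve $\alpha:[a,b]\to\mathbb R^n$ is given by $\alpha(t)=\alpha^0(l(\alpha|_{[a,t]}))$. For a Borel function $\rho:\mathbb R^n\to[0,\infty]$, $\int_\gamma\rho\,|dx|$ is the supremum of $\int_0^{l(\alpha)}\rho(\alpha^0(s))\,ds$ over the closed subcurves $\alpha$ of $\gamma$. The $p$-modulus of a family $\Gamma$ of curves is $M_p(\Gamma)=\inf\int_{\mathbb R^n}\rho^p\,dm$ over all Borel $\rho:\mathbb R^n\to[0,\infty]$ with $\int_\gamma\rho\,|dx|\ge1$ for every locally rectifiable $\gamma\in\Gamma$. A property holds for $p$-almost all curves in $D$ if the curves in $D$ for which it fails belong to a family of zero $p$-modulus. The mapping. Let $f:D\to\mathbb R^n$ be differentiable almost everywhere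 in $D$, with Luzin's property $N$ ($m(E)=0\Rightarrow m(f(E))=0$ for $E\subset D$) and Luzin's property $N^{-1}$ ($m(E)=0\Rightarrow m(f^{-1}(E))=0$ for $E\subset\mathbb R^n$), and let $f\in ACP_p(D)$: for $p$-almost all curves $\gamma$ in $D$, $\gamma$ is locally rectifiable and $f\circ\alpha^0$ is absolutely continuous on $[0,l(\alpha)]$ for every closed subcurve $\alpha$ of $\gamma$. Let $y_0\in\overline{f(D)}$ be a (finite) point of $\mathbb R^n$, and for $y\in\mathbb R^n$ put $$K_{CT,p,y_0}(y,f)=\sum_{x\in f^{-1}(y)}\frac{\Bigl(\sup_{|h|=1}\Bigl|\Bigl(f'(x)h,\frac{f(x)-y_0}{|f(x)-y_0|}\Bigr)\Bigr|\Bigr)^p}{|J(x,f)|},\qquad J(x,f)=\det f'(x),$$ where $(\cdot,\cdot)$ is the scalar product. (Here $a/0=\infty$ for $a>0$ and $0/0=0$, and $f'(x)$ is read as $0$ where $f$ is not differentiable.) For $0<r_1<r_2<\infty$ let $A=A(y_0,r_1,r_2)=\{y:r_1<|y-y_0|<r_2\}$ and let $\Gamma_f(y_0,r_1,r_2)$ be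 the family of all curves $\gamma:[a,b]\to D$ such that $f\circ\gamma$ is a curve (i.e. is continuous) with $|f(\gamma(a))-y_0|=r_1$, $|f(\gamma(b))-y_0|=r_2$ and $f(\gamma(t))\in A$ for $a<t<b$. Theorem. Under these assumptions $y\mapsto K_{CT,p,y_0}(y,f)$ is Lebesgue measurable on $\mathbb R^n$, and $f$ satisfies the inverse Poletsky inequality at $y_0$ with respect to the $p$-modulus with this weight: for all $0<r_1<r_2<\sup_{y\in f(D)}|y-y_0|$ and every Lebesgue measurable $\eta:(r_1,r_2)\to[0,\infty]$ with $\int_{r_1}^{r_2}\eta(r)\,dr\ge1$, $$M_p(\Gamma_f(y_0,r_1,r_2))\le\int_{A(y_0,r_1,r_2)\cap f(D)}K_{CT,p,y_0}(y,f)\,\eta^p(|y-y_0|)\,dm(y).$$ -/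

import Mathlib

open Set MeasureTheory
open scoped ENNReal

noncomputable section

namespace Poletsky

/-- The Euclidean space `ℝⁿ`. -/
abbrev E (n : ℕ) : Type := EuclideanSpace ℝ (Fin n)

/-- A curve in `ℝⁿ`: a continuous map of an interval (open, closed, half-open, bounded or not).
The values of `toFun` outside `dom` play no role. -/
structure Curve (n : ℕ) where
  dom : Set ℝ
  dom_nonempty : dom.Nonempty
  dom_ordConnected : dom.OrdConnected
  toFun : ℝ → E n
  continuousOn : ContinuousOn toFun dom

namespace Curve

variable {n : ℕ}

/-- The curve lies in the set `D`. -/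
def LiesIn (γ : Curve n) (D : Set (E n)) : Prop :=
  ∀ t ∈ γ.dom, γ.toFun t ∈ D

/-- Every closed subcurve has finite length. -/
def LocallyRectifiable (γ : Curve n) : Prop :=
  LocallyBoundedVariationOn γ.toFun γ.dom

/-- The length `S(γ, [a, b])` of the closed subcurve `γ|[a,b]`. -/
def length (γ : Curve n) (a b : ℝ) : ℝ :=
  (eVariationOn γ.toFun (Icc a b)).toReal

/-- The normal representation `α⁰ : [0, l(α)] → ℝⁿ` of the closed rectifiable subcurve
`α = γ|[a,b]`; it satisfies `α⁰ (S(γ, [a, t])) = γ t`. -/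
def normalRep (γ : Curve n) (a b : ℝ) : ℝ → E n :=
  naturalParameterization γ.toFun (Icc a b) a

/-- The defining property of the normal representation. -/
theorem normalRep_length (γ : Curve n) (hγ : γ.LocallyRectifiable) {a b t : ℝ}
    (ha : a ∈ γ.dom) (hb : b ∈ γ.dom) (ht : t ∈ Icc a b) :
    γ.normalRep a b (γ.length a t) = γ.toFun t := by
  have hsub : Icc a b ⊆ γ.dom := γ.dom_ordConnected.out ha hb
  have hloc : LocallyBoundedVariationOn γ.toFun (Icc a b) := fun x y hx hy =>
    (hγ x y (hsub hx) (hsub hy)).mono (inter_subset_inter_left _ hsub)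
  have hab : a ∈ Icc a b := ⟨le_refl a, ht.1.trans ht.2⟩
  have h := edist_naturalParameterization_eq_zero hloc hab ht
  have hI : Icc a b ∩ Icc a t = Icc a t :=
    inter_eq_right.mpr (Icc_subset_Icc_right ht.2)
  rw [variationOnFromTo.eq_of_le _ _ ht.1, hI] at h
  exact edist_eq_zero.mp h

/-- The line integral `∫_γ ρ |dx|` along a locally rectifiable curve: the supremum of the
integrals, with respect to arc length, over the closed subcurves. -/
def lineIntegral (γ : Curve n) (ρ : E n → ℝ≥0∞) : ℝ≥0∞ :=
  ⨆ (a ∈ γ.dom) (b ∈ γ.dom) (_ : a ≤ b),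
    ∫⁻ s in Icc 0 (γ.length a b), ρ (γ.normalRep a b s)

end Curve

variable {n : ℕ}

/-- `ρ ∈ adm Γ`: `ρ` is a Borel function with `∫_γ ρ |dx| ≥ 1` for every locally rectifiable
`γ ∈ Γ`. -/
def Admissible (Γ : Set (Curve n)) (ρ : E n → ℝ≥0∞) : Prop :=
  Measurable ρ ∧ ∀ γ ∈ Γ, γ.LocallyRectifiable → 1 ≤ γ.lineIntegral ρ

/-- The `p`-modulus `M_p(Γ)` of a family of curves. -/
def modulus (p : ℝ) (Γ : Set (Curve n)) : ℝ≥0∞ :=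
  ⨅ (ρ : E n → ℝ≥0∞) (_ : Admissible Γ ρ), ∫⁻ x, ρ x ^ p

/-- The property `P` holds for `p`-almost all curves in `D`. -/
def ForAlmostAllCurves (p : ℝ) (D : Set (E n)) (P : Curve n → Prop) : Prop :=
  ∃ Γ₀ : Set (Curve n), modulus p Γ₀ = 0 ∧ ∀ γ : Curve n, γ.LiesIn D → γ ∉ Γ₀ → P γ

/-- `f` is locally absolutely continuous on the locally rectifiable curve `γ`: for every closed
subcurve `α` of `γ`, the composition `f ∘ α⁰` is absolutely continuous on `[0, l(α)]`. -/
def LocallyAbsContOn (f : E n → E n) (γ : Curve n) : Prop :=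
  γ.LocallyRectifiable ∧ ∀ a ∈ γ.dom, ∀ b ∈ γ.dom, a ≤ b →
    AbsolutelyContinuousOnInterval (f ∘ γ.normalRep a b) 0 (γ.length a b)

/-- The class `ACP_p(D)`: local absolute continuity on `p`-almost all curves in `D`. (The curves
that are not locally rectifiable form a family of zero modulus.) -/
def ACP (p : ℝ) (D : Set (E n)) (f : E n → E n) : Prop :=
  ForAlmostAllCurves p D (LocallyAbsContOn f)

/-- Luzin's `N`-property of `f : D → ℝⁿ`. -/
def LuzinN (D : Set (E n)) (f : E n → E n) : Prop :=
  ∀ s ⊆ D, volume s = 0 → volume (f '' s) = 0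

/-- Luzin's `N⁻¹`-property of `f : D → ℝⁿ`. -/
def LuzinNInv (D : Set (E n)) (f : E n → E n) : Prop :=
  ∀ s : Set (E n), volume s = 0 → volume (D ∩ f ⁻¹' s) = 0

/-- The open spherical ring `A(y₀, r₁, r₂)`. -/
def sphericalRing (y₀ : E n) (r₁ r₂ : ℝ) : Set (E n) :=
  {y | r₁ < ‖y - y₀‖ ∧ ‖y - y₀‖ < r₂}

/-- `Γ(F₁, F₂, G)`: the curves `γ : [a, b] → ℝⁿ` with `γ(a) ∈ F₁`, `γ(b) ∈ F₂` and
`γ(t) ∈ G` for `a < t < b`. -/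
def joiningCurves (F₁ F₂ G : Set (E n)) : Set (Curve n) :=
  {γ | ∃ a b : ℝ, a ≤ b ∧ γ.dom = Icc a b ∧ γ.toFun a ∈ F₁ ∧ γ.toFun b ∈ F₂ ∧
    ∀ t ∈ Ioo a b, γ.toFun t ∈ G}

/-- `Γ_f(y₀, r₁, r₂)`: the curves `γ` in `D` whose image `f ∘ γ` is a curve of the family
`Γ(S(y₀, r₁), S(y₀, r₂), A(y₀, r₁, r₂))`. -/
def preimageCurves (D : Set (E n)) (f : E n → E n) (y₀ : E n) (r₁ r₂ : ℝ) : Set (Curve n) :=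
  {γ | γ.LiesIn D ∧
    ∃ β ∈ joiningCurves (Metric.sphere y₀ r₁) (Metric.sphere y₀ r₂) (sphericalRing y₀ r₁ r₂),
      β.dom = γ.dom ∧ EqOn β.toFun (f ∘ γ.toFun) γ.dom}

/-- The inverse Poletsky inequality for `f : D → ℝⁿ` at `y₀` with respect to the `p`-modulus,
with the Lebesgue measurable weight `Q`; here `r₂ < r₀ = sup {|y - y₀| : y ∈ f(D)} ≤ ∞`. -/
def InversePoletsky (p : ℝ) (D : Set (E n)) (f : E n → E n) (y₀ : E n)
    (Q : E n → ℝ≥0∞) : Prop :=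
  AEMeasurable Q volume ∧
  ∀ r₁ r₂ : ℝ, 0 < r₁ → r₁ < r₂ → ENNReal.ofReal r₂ < (⨆ y ∈ f '' D, edist y y₀) →
    ∀ η : ℝ → ℝ≥0∞, AEMeasurable η (volume.restrict (Ioo r₁ r₂)) →
      1 ≤ ∫⁻ r in Ioo r₁ r₂, η r →
      modulus p (preimageCurves D f y₀ r₁ r₂) ≤
        ∫⁻ y in sphericalRing y₀ r₁ r₂ ∩ f '' D, Q y * η ‖y - y₀‖ ^ p

/-- The cotangent dilatation
`K_{CT,p,y₀}(y, f) = ∑_{x ∈ D, f(x) = y} (sup_{|h|=1} |(f'(x)h, (f(x)-y₀)/|f(x)-y₀|)|)^p / |J(x,f)|`.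
The values `a / 0 = ∞` for `a > 0` and `0 / 0 = 0` are used where `J(x,f) = 0`, and `f'(x)` is read
as `0` where `f` is not differentiable. -/
def cotangentDilatation (p : ℝ) (D : Set (E n)) (f : E n → E n) (y₀ y : E n) : ℝ≥0∞ :=
  ∑' x : {x : E n // x ∈ D ∧ f x = y},
    (⨆ h ∈ Metric.sphere (0 : E n) 1,
        ENNReal.ofReal |inner ℝ (fderiv ℝ f x h) (‖f x - y₀‖⁻¹ • (f x - y₀))|) ^ p /
      ENNReal.ofReal |(fderiv ℝ f x).det|

end Poletsky

end

/-! Let `B` be the set of points of `D` where `f` is differentiable with nonzero Jacobian. By Sard's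
theorem and N⁻¹, `D \ B` is null (`volume_sdiff_regular_eq_zero`). Take ρ = η(|f - y₀|) ·
`radialStretch` on `B`, and ρ = ∞ on a Borel null set containing `D \ B`. Along a curve on which `f`
is absolutely continuous, φ = |f ∘ γ⁰ - y₀| is absolutely continuous from r₁ to r₂, and |φ'| is at
most the radial stretch wherever γ⁰ avoids the null set. The one-dimensional inequality ∫ η ≤ ∫
η(φ)|φ'| (`lintegral_Ioo_le`) then gives ∫ ρ ≥ 1; the exceptional curves cost nothing
(`modulus_le_add`). The area formula on `B` turns ∫ ρ^p into the integral of η^p times the fibre sum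
over `B`, which is at most the dilatation. Property N makes the two fibre sums agree almost
everywhere, whence measurability. -/

open Filter Topology
open scoped NNReal

/-! ### Change of variables for absolutely continuous functions -/

theorem LipschitzWith.comp_absolutelyContinuousOnInterval {X Y : Type*} [PseudoMetricSpace X]
    [PseudoMetricSpace Y] {g : X → Y} {C : ℝ≥0} (hg : LipschitzWith C g) {f : ℝ → X} {a b : ℝ}
    (hf : AbsolutelyContinuousOnInterval f a b) :
    AbsolutelyContinuousOnInterval (g ∘ f) a b := by
  refine squeeze_zero (fun t ↦ Finset.sum_nonneg fun i _ ↦ dist_nonneg) (fun t ↦ ?_)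
    (by simpa using Tendsto.const_mul (C : ℝ) hf)
  rw [Finset.mul_sum]
  exact Finset.sum_le_sum fun i _ ↦ hg.dist_le_mul _ _

/-- Compose φ with the 1-Lipschitz primitive `F` of the indicator of `K`: the increment of `F ∘ φ`
is |K|, and its derivative is bounded by |φ'|. It vanishes where φ is differentiable with value off
`K`, because `K` is closed and `F` is locally constant there. No chain rule for `F` is needed. -/
theorem AbsolutelyContinuousOnInterval.volume_le_lintegral_of_isCompact {φ : ℝ → ℝ} {a b : ℝ}
    (hab : a ≤ b) (hφ : AbsolutelyContinuousOnInterval φ a b) {K : Set ℝ} (hK : IsCompact K)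
    (hKsub : K ⊆ Ioo (φ a) (φ b)) :
    volume K ≤ ∫⁻ s in Icc a b ∩ φ ⁻¹' K, ‖deriv φ s‖ₑ := by
  rcases K.eq_empty_or_nonempty with rfl | ⟨k, hk⟩
  · simp
  have hlt : φ a < φ b := (hKsub hk).1.trans (hKsub hk).2
  set F : ℝ → ℝ := fun r ↦ ∫ x in (φ a)..r, K.indicator (fun _ ↦ (1 : ℝ)) x with hF
  have hKm : MeasurableSet K := hK.measurableSet
  have hint : Integrable (K.indicator fun _ ↦ (1 : ℝ)) volume :=
    (integrable_indicator_iff hKm).2 (integrableOn_const hK.measure_lt_top.ne)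
  have hsub : ∀ c d, F d - F c = ∫ x in c..d, K.indicator (fun _ ↦ (1 : ℝ)) x := fun c d ↦
    intervalIntegral.integral_interval_sub_left hint.intervalIntegrable hint.intervalIntegrable
  have hLip : LipschitzWith 1 F := by
    refine LipschitzWith.of_dist_le_mul fun c d ↦ ?_
    rw [dist_comm, Real.dist_eq, hsub, ← Real.norm_eq_abs, NNReal.coe_one, dist_comm, Real.dist_eq]
    refine intervalIntegral.norm_integral_le_of_norm_le_const fun x _ ↦ ?_
    by_cases hx : x ∈ K <;> simp [hx]
  have hG : AbsolutelyContinuousOnInterval (F ∘ φ) a b :=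
    hLip.comp_absolutelyContinuousOnInterval hφ
  have hval : volume K = ENNReal.ofReal (∫ s in a..b, deriv (F ∘ φ) s) := by
    rw [hG.integral_deriv_eq_sub, Function.comp_apply, Function.comp_apply, hsub,
      intervalIntegral.integral_of_le hlt.le, integral_indicator hKm, setIntegral_const,
      Measure.real, Measure.restrict_apply hKm,
      inter_eq_left.2 (hKsub.trans Ioo_subset_Ioc_self)]
    simp [ENNReal.ofReal_toReal hK.measure_lt_top.ne]
  have hφc : ContinuousOn φ (Icc a b) := by simpa [uIcc_of_le hab] using hφ.continuousOn
  have hmeas : MeasurableSet (Icc a b ∩ φ ⁻¹' K) :=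
    (hφc.preimage_isClosed_of_isClosed isClosed_Icc hK.isClosed).measurableSet
  calc volume K ≤ ENNReal.ofReal ‖∫ s in Ioc a b, deriv (F ∘ φ) s‖ := by
        rw [hval, intervalIntegral.integral_of_le hab]
        exact ENNReal.ofReal_le_ofReal (le_abs_self _)
    _ ≤ ∫⁻ s in Ioc a b, ‖deriv (F ∘ φ) s‖ₑ := by
        rw [ofReal_norm]
        exact enorm_integral_le_lintegral_enorm _
    _ = ∫⁻ s in Ioo a b, ‖deriv (F ∘ φ) s‖ₑ := by
        rw [restrict_Ioo_eq_restrict_Ioc]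
    _ ≤ ∫⁻ s in Ioo a b, (φ ⁻¹' K).indicator (fun s ↦ ‖deriv φ s‖ₑ) s := by
        refine lintegral_mono_ae ((ae_restrict_iff' measurableSet_Ioo).2 ?_)
        filter_upwards [hφ.ae_differentiableAt, hG.ae_differentiableAt] with s hs hs' hsm
        have hmem : s ∈ uIcc a b := by
          rw [uIcc_of_le hab]; exact Ioo_subset_Icc_self hsm
        by_cases hsK : φ s ∈ K
        · rw [indicator_of_mem (show s ∈ φ ⁻¹' K from hsK)]
          have h1 := (hs hmem).hasDerivAt
          have h2 := (hs' hmem).hasDerivAt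
          rw [hasDerivAt_iff_tendsto_slope] at h1 h2
          have hle : ‖deriv (F ∘ φ) s‖ ≤ ‖deriv φ s‖ := by
            refine le_of_tendsto_of_tendsto h2.norm h1.norm (Eventually.of_forall fun t ↦ ?_)
            simp only [slope_def_field, norm_div, Function.comp_apply]
            gcongr
            simpa [dist_eq_norm] using hLip.dist_le_mul (φ t) (φ s)
          simpa only [ofReal_norm] using ENNReal.ofReal_le_ofReal hle
        · have hev : F ∘ φ =ᶠ[𝓝 s] fun _ ↦ F (φ s) := by
            obtain ⟨ε, hε, hball⟩ := Metric.isOpen_iff.1 hK.isClosed.isOpen_compl (φ s) hsK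
            filter_upwards [(hs hmem).continuousAt.preimage_mem_nhds (Metric.ball_mem_nhds _ hε)]
              with t ht
            have : ∫ x in (φ s)..(φ t), K.indicator (fun _ ↦ (1 : ℝ)) x = 0 := by
              refine (intervalIntegral.integral_congr fun x hx ↦ ?_).trans
                intervalIntegral.integral_zero
              have hxb : x ∈ Metric.ball (φ s) ε :=
                (convex_ball (φ s) ε).ordConnected.uIcc_subset (Metric.mem_ball_self hε) ht hx
              exact indicator_of_notMem (hball hxb) _
            rw [← hsub] at this
            simpa [sub_eq_zero] using this
          simp [hev.deriv_eq]
    _ ≤ ∫⁻ s in Icc a b, (φ ⁻¹' K).indicator (fun s ↦ ‖deriv φ s‖ₑ) s :=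
        lintegral_mono_set Ioo_subset_Icc_self
    _ = ∫⁻ s in Icc a b ∩ φ ⁻¹' K, ‖deriv φ s‖ₑ := by
        rw [← lintegral_indicator measurableSet_Icc, indicator_indicator,
          lintegral_indicator hmeas]

/-- Equivalent to a comparison of measures: Lebesgue measure on the target interval is at most the
image under φ of |φ'| ds. Inner regularity reduces this to compact sets. -/
theorem AbsolutelyContinuousOnInterval.lintegral_Ioo_le {φ : ℝ → ℝ} {a b : ℝ}
    (hab : a ≤ b) (hφ : AbsolutelyContinuousOnInterval φ a b) {g : ℝ → ℝ≥0∞}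
    (hg : Measurable g) :
    ∫⁻ r in Ioo (φ a) (φ b), g r ≤
      ∫⁻ s in Icc a b, (Ioo (φ a) (φ b)).indicator g (φ s) * ‖deriv φ s‖ₑ := by
  have hφc : ContinuousOn φ (Icc a b) := by simpa [uIcc_of_le hab] using hφ.continuousOn
  have hd : Measurable fun s ↦ ‖deriv φ s‖ₑ := (measurable_deriv φ).enorm
  set μ := (volume.restrict (Icc a b)).withDensity fun s ↦ ‖deriv φ s‖ₑ with hμ
  have hφm : AEMeasurable φ (volume.restrict (Icc a b)) := hφc.aemeasurable measurableSet_Icc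
  have hφm' : AEMeasurable φ μ := hφm.mono_ac (withDensity_absolutelyContinuous _ _)
  have hle : volume.restrict (Ioo (φ a) (φ b)) ≤ μ.map φ := by
    refine Measure.le_iff.2 fun B hB ↦ ?_
    rw [Measure.restrict_apply hB, (hB.inter measurableSet_Ioo).measure_eq_iSup_isCompact]
    refine iSup₂_le fun K hK ↦ iSup_le fun hKc ↦ ?_
    refine (hφ.volume_le_lintegral_of_isCompact hab hKc (hK.trans inter_subset_right)).trans ?_
    have hmeas : MeasurableSet (Icc a b ∩ φ ⁻¹' K) :=
      (hφc.preimage_isClosed_of_isClosed isClosed_Icc hKc.isClosed).measurableSet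
    calc ∫⁻ s in Icc a b ∩ φ ⁻¹' K, ‖deriv φ s‖ₑ = μ (Icc a b ∩ φ ⁻¹' K) := by
          rw [hμ, withDensity_apply _ hmeas, Measure.restrict_restrict hmeas, inter_assoc,
            inter_comm (φ ⁻¹' K), ← inter_assoc, inter_self]
      _ ≤ μ (φ ⁻¹' B) := measure_mono (inter_subset_right.trans
          (preimage_mono (hK.trans inter_subset_left)))
      _ = μ.map φ B := (Measure.map_apply_of_aemeasurable hφm' hB).symm
  have hgi : Measurable ((Ioo (φ a) (φ b)).indicator g) := hg.indicator measurableSet_Ioo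
  calc ∫⁻ r in Ioo (φ a) (φ b), g r
      = ∫⁻ r in Ioo (φ a) (φ b), (Ioo (φ a) (φ b)).indicator g r := by
        refine setLIntegral_congr_fun measurableSet_Ioo fun r hr ↦ ?_
        simp [hr]
    _ ≤ ∫⁻ r, (Ioo (φ a) (φ b)).indicator g r ∂(μ.map φ) := lintegral_mono' hle le_rfl
    _ = ∫⁻ s, (Ioo (φ a) (φ b)).indicator g (φ s) ∂μ :=
        lintegral_map' hgi.aemeasurable hφm'
    _ = _ := by
        refine (lintegral_withDensity_eq_lintegral_mul₀ hd.aemeasurable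
          (hgi.comp_aemeasurable hφm)).trans ?_
        simp [mul_comm]

/-! ### Normal representation and modulus -/

namespace Poletsky

namespace Curve

variable {n : ℕ}

theorem length_nonneg (γ : Curve n) (a b : ℝ) : 0 ≤ γ.length a b := ENNReal.toReal_nonneg

theorem LocallyRectifiable.mono {γ : Curve n} (hγ : γ.LocallyRectifiable) {a b : ℝ}
    (hsub : Icc a b ⊆ γ.dom) : LocallyBoundedVariationOn γ.toFun (Icc a b) := fun x y hx hy =>
  (hγ x y (hsub hx) (hsub hy)).mono (inter_subset_inter_left _ hsub)

theorem variationOnFromTo_image (γ : Curve n) (hγ : γ.LocallyRectifiable) {a b : ℝ}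
    (hsub : Icc a b ⊆ γ.dom) (hab : a ≤ b) :
    variationOnFromTo γ.toFun (Icc a b) a '' Icc a b = Icc 0 (γ.length a b) := by
  have hloc := hγ.mono hsub
  have ha : a ∈ Icc a b := left_mem_Icc.2 hab
  have hb : b ∈ Icc a b := right_mem_Icc.2 hab
  have hmono := variationOnFromTo.monotoneOn hloc ha
  have hVb : variationOnFromTo γ.toFun (Icc a b) a b = γ.length a b := by
    rw [variationOnFromTo.eq_of_le _ _ hab, inter_self, Curve.length]
  have hVa : variationOnFromTo γ.toFun (Icc a b) a a = 0 := variationOnFromTo.self _ _ _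
  have hcont : ContinuousOn (variationOnFromTo γ.toFun (Icc a b) a) (Icc a b) := by
    intro t ht
    have hγt : ContinuousWithinAt γ.toFun (Icc a b) t := (γ.continuousOn.mono hsub) t ht
    -- The one-sided limits of the variation differ from its value by the jumps of the curve, which
    -- are zero.
    have h1 := variationOnFromTo.tendsto_left ha ht hloc (hγt.mono inter_subset_left)
    have h2 := variationOnFromTo.tendsto_right ha ht hloc (hγt.mono inter_subset_left)
    rw [dist_self, sub_zero] at h1
    rw [dist_self, add_zero] at h2
    refine continuousWithinAt_sdiff_self.1 ?_
    have : Icc a b \ {t} = (Icc a b ∩ Iio t) ∪ (Icc a b ∩ Ioi t) := by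
      rw [← inter_union_distrib_left, Iio_union_Ioi]; rfl
    rw [ContinuousWithinAt, this, nhdsWithin_union]
    exact h1.sup h2
  refine Subset.antisymm ?_ ?_
  · rintro _ ⟨t, ht, rfl⟩
    exact ⟨hVa ▸ hmono ha ht ht.1, hVb ▸ hmono ht hb ht.2⟩
  · have := intermediate_value_Icc hab hcont
    rwa [hVa, hVb] at this

theorem normalRep_lipschitzOnWith (γ : Curve n) (hγ : γ.LocallyRectifiable) {a b : ℝ}
    (hsub : Icc a b ⊆ γ.dom) (hab : a ≤ b) :
    LipschitzOnWith 1 (γ.normalRep a b) (Icc 0 (γ.length a b)) := by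
  have h := has_unit_speed_naturalParameterization γ.toFun (hγ.mono hsub) (left_mem_Icc.2 hab)
  rw [γ.variationOnFromTo_image hγ hsub hab] at h
  have key : ∀ x ∈ Icc 0 (γ.length a b), ∀ y ∈ Icc 0 (γ.length a b), x ≤ y →
      edist (γ.normalRep a b x) (γ.normalRep a b y) ≤ edist x y := by
    intro x hx y hy hxy
    calc edist (γ.normalRep a b x) (γ.normalRep a b y)
        ≤ eVariationOn (γ.normalRep a b) (Icc 0 (γ.length a b) ∩ Icc x y) :=
          eVariationOn.edist_le _ ⟨hx, le_rfl, hxy⟩ ⟨hy, hxy, le_rfl⟩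
      _ = ENNReal.ofReal (y - x) := by simpa [normalRep] using h hx hy
      _ = edist x y := by
          rw [edist_comm, edist_dist, Real.dist_eq, abs_of_nonneg (sub_nonneg.2 hxy)]
  intro x hx y hy
  rw [ENNReal.coe_one, one_mul]
  rcases le_total x y with hxy | hxy
  · exact key x hx y hy hxy
  · rw [edist_comm, edist_comm x]
    exact key y hy x hx hxy

theorem normalRep_mapsTo (γ : Curve n) (hγ : γ.LocallyRectifiable) {a b : ℝ}
    (hsub : Icc a b ⊆ γ.dom) (hab : a ≤ b) :
    MapsTo (γ.normalRep a b) (Icc 0 (γ.length a b)) (γ.toFun '' Icc a b) := by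
  rw [← γ.variationOnFromTo_image hγ hsub hab]
  rintro s hs
  exact ⟨_, Function.invFunOn_mem hs, rfl⟩

theorem normalRep_zero (γ : Curve n) (hγ : γ.LocallyRectifiable) {a b : ℝ}
    (ha : a ∈ γ.dom) (hb : b ∈ γ.dom) (hab : a ≤ b) : γ.normalRep a b 0 = γ.toFun a := by
  have h := γ.normalRep_length hγ ha hb (left_mem_Icc.2 hab)
  rwa [length, eVariationOn.subsingleton _ (by simp), ENNReal.toReal_zero] at h

end Curve

/-- The maximum of ρ and a function σ admissible for `Γ₀` is admissible for `Γ`, and its p-th power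
is at most ρ^p + σ^p. -/
theorem modulus_le_add {n : ℕ} {p : ℝ} {Γ Γ₀ : Set (Curve n)} {ρ : E n → ℝ≥0∞}
    (hρ : Measurable ρ)
    (h : ∀ γ ∈ Γ, γ ∉ Γ₀ → γ.LocallyRectifiable → 1 ≤ γ.lineIntegral ρ) :
    modulus p Γ ≤ (∫⁻ x, ρ x ^ p) + modulus p Γ₀ := by
  simp only [modulus, ENNReal.add_iInf]
  refine le_iInf₂ fun σ hσ ↦ ?_
  have hmono : ∀ (γ : Curve n) {ρ₁ ρ₂ : E n → ℝ≥0∞}, ρ₁ ≤ ρ₂ →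
      γ.lineIntegral ρ₁ ≤ γ.lineIntegral ρ₂ := fun γ ρ₁ ρ₂ hle ↦
    iSup₂_mono fun a _ ↦ iSup₂_mono fun b _ ↦ iSup_mono fun _ ↦ lintegral_mono fun s ↦ hle _
  have hadm : Admissible Γ (ρ ⊔ σ) := by
    refine ⟨hρ.sup hσ.1, fun γ hγ hr ↦ ?_⟩
    by_cases h0 : γ ∈ Γ₀
    · exact (hσ.2 γ h0 hr).trans (hmono γ le_sup_right)
    · exact (h γ hγ h0 hr).trans (hmono γ le_sup_left)
  · refine (iInf₂_le (ρ ⊔ σ) hadm).trans ?_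
    rw [← lintegral_add_left (hρ.pow_const p)]
    refine lintegral_mono fun x ↦ ?_
    rcases le_total (ρ x) (σ x) with hx | hx
    · simp [hx]
    · simp [hx]

end Poletsky

/-! ### Area formula with multiplicity, and null sets of radii -/

section AreaFormula

variable {F : Type*} [NormedAddCommGroup F] [NormedSpace ℝ F] [FiniteDimensional ℝ F]

/-- A map that differs from an invertible linear `B` by a Lipschitz error smaller than 1/‖B⁻¹‖ is
injective. -/
theorem exists_measurable_partition_injOn {f : F → F} {f' : F → F →L[ℝ] F} {s : Set F}
    [MeasurableSpace F] [BorelSpace F] (hs : MeasurableSet s)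
    (hf' : ∀ x ∈ s, HasFDerivWithinAt f (f' x) s x) (hdet : ∀ x ∈ s, (f' x).det ≠ 0) :
    ∃ t : ℕ → Set F, Pairwise (Function.onFun Disjoint t) ∧ (∀ n, MeasurableSet (t n)) ∧
      s = ⋃ n, t n ∧ ∀ n, InjOn f (t n) := by
  rcases s.eq_empty_or_nonempty with rfl | hne
  · exact ⟨fun _ ↦ ∅, fun _ _ _ ↦ disjoint_empty _, fun _ ↦ .empty, by simp, fun _ ↦ injOn_empty _⟩
  have hr : ∀ A : F →L[ℝ] F, ∃ r : ℝ≥0, r ≠ 0 ∧ (A.det ≠ 0 → ∀ u : Set F,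
      ApproximatesLinearOn f A u r → InjOn f u) := by
    intro A
    by_cases hA : A.det = 0
    · exact ⟨1, one_ne_zero, fun h ↦ absurd hA h⟩
    set B := A.toContinuousLinearEquivOfDetNeZero hA with hB
    have hBA : (B : F →L[ℝ] F) = A := A.coe_toContinuousLinearEquivOfDetNeZero hA
    rcases subsingleton_or_nontrivial F with hF | hF
    · exact ⟨1, one_ne_zero, fun _ u _ x _ y _ _ ↦ Subsingleton.elim _ _⟩
    · have hpos : 0 < ‖(B.symm : F →L[ℝ] F)‖₊⁻¹ := inv_pos.2 B.nnnorm_symm_pos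
      refine ⟨‖(B.symm : F →L[ℝ] F)‖₊⁻¹ / 2, (half_pos hpos).ne', fun _ u hu ↦ ?_⟩
      rw [← hBA] at hu
      exact hu.injOn (Or.inr (half_lt_self hpos))
  choose r hr0 hrinj using hr
  obtain ⟨t, A, hdisj, hmeas, hcov, happrox, hA⟩ :=
    exists_partition_approximatesLinearOn_of_hasFDerivWithinAt f s f' hf' r hr0
  refine ⟨fun n ↦ s ∩ t n, fun i j hij ↦ (hdisj hij).mono inter_subset_right inter_subset_right,
    fun n ↦ hs.inter (hmeas n), ?_, fun n ↦ ?_⟩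
  · rw [← inter_iUnion, inter_eq_left.2 hcov]
  -- Each approximating linear map is a derivative at a point of `s`, hence invertible.
  · obtain ⟨y, hy, hAy⟩ := hA hne n
    exact hrinj (A n) (hAy ▸ hdet y hy) _ (happrox n)

/-- On an injective piece a fibre has at most one point; the `Function.extend` form gives
measurability through measurable embeddings. -/
theorem extend_domRestrict_eq_tsum {α β : Type*} {f : α → β} {t : Set α} (hf : InjOn f t)
    (h : α → ℝ≥0∞) (y : β) :
    Function.extend (t.domRestrict f) (t.domRestrict h) 0 y = ∑' x : ↥(t ∩ f ⁻¹' {y}), h x := by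
  by_cases hy : ∃ x : t, t.domRestrict f x = y
  · obtain ⟨x, rfl⟩ := hy
    rw [(injOn_iff_injective.1 hf).extend_apply]
    have : t ∩ f ⁻¹' {t.domRestrict f x} = {(x : α)} := by
      ext z
      refine ⟨fun hz ↦ hf hz.1 x.2 hz.2, ?_⟩
      rintro rfl
      exact ⟨x.2, rfl⟩
    rw [this, tsum_singleton (x : α) h]
    rfl
  · rw [Function.extend_apply' _ _ _ hy]
    have : t ∩ f ⁻¹' {y} = ∅ := by
      refine eq_empty_of_forall_notMem fun z hz ↦ hy ⟨⟨z, hz.1⟩, hz.2⟩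
    rw [this]
    simp

variable [MeasurableSpace F] [BorelSpace F] (μ : Measure F) [μ.IsAddHaarMeasure]

/-- The area formula for a map that is differentiable with nonzero Jacobian on a Borel set. -/
theorem measurable_tsum_preimage_and_lintegral_eq {f : F → F} {f' : F → F →L[ℝ] F} {s : Set F}
    (hs : MeasurableSet s) (hf' : ∀ x ∈ s, HasFDerivWithinAt f (f' x) s x)
    (hdet : ∀ x ∈ s, (f' x).det ≠ 0) {h : F → ℝ≥0∞} (hh : Measurable h) :
    Measurable (fun y ↦ ∑' x : ↥(s ∩ f ⁻¹' {y}), h x) ∧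
      ∫⁻ y, (∑' x : ↥(s ∩ f ⁻¹' {y}), h x) ∂μ =
        ∫⁻ x in s, ENNReal.ofReal |(f' x).det| * h x ∂μ := by
  obtain ⟨t, hdisj, ht, rfl, hinj⟩ := exists_measurable_partition_injOn hs hf' hdet
  have hft : ∀ n, ∀ x ∈ t n, HasFDerivWithinAt f (f' x) (t n) x := fun n x hx ↦
    (hf' x (mem_iUnion_of_mem n hx)).mono (subset_iUnion t n)
  set N : ℕ → F → ℝ≥0∞ := fun n ↦
    Function.extend ((t n).domRestrict f) ((t n).domRestrict h) 0 with hN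
  have hNm : ∀ n, Measurable (N n) := fun n ↦
    (measurableEmbedding_of_fderivWithin (ht n) (hft n) (hinj n)).measurable_extend
      (hh.comp measurable_subtype_coe) measurable_zero
  have hsum : ∀ y, ∑' x : ↥((⋃ n, t n) ∩ f ⁻¹' {y}), h x = ∑' n, N n y := by
    intro y
    rw [iUnion_inter, ENNReal.tsum_biUnion (t := fun n ↦ t n ∩ f ⁻¹' {y})]
    · exact tsum_congr fun n ↦ (extend_domRestrict_eq_tsum (hinj n) h y).symm
    · exact fun i _ j _ hij ↦ (hdisj hij).mono inter_subset_left inter_subset_left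
  simp only [hsum]
  refine ⟨Measurable.tsum hNm, ?_⟩
  rw [lintegral_tsum fun n ↦ (hNm n).aemeasurable, lintegral_iUnion ht hdisj]
  refine tsum_congr fun n ↦ ?_
  have hsupp : ∀ y ∉ f '' t n, N n y = 0 := fun y hy ↦
    Function.extend_apply' _ _ _ fun ⟨x, hx⟩ ↦ hy ⟨x, x.2, hx⟩
  rw [← setLIntegral_eq_of_support_subset (s := f '' t n) (fun y hy ↦ by
      by_contra h0; exact hy (hsupp y h0)),
    lintegral_image_eq_lintegral_abs_det_fderiv_mul μ (ht n) (hft n) (hinj n)]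
  refine setLIntegral_congr_fun (ht n) fun x hx ↦ ?_
  have : N n (f x) = h x :=
    (injOn_iff_injective.1 (hinj n)).extend_apply ((t n).domRestrict h) 0 ⟨x, hx⟩
  simp only [this]

/-- Polar coordinates. This allows a Lebesgue measurable η to be replaced by a Borel representative.
-/
theorem measure_norm_sub_mem_eq_zero [Nontrivial F] {N : Set ℝ} (hN : volume N = 0) (c : F) :
    μ {y | ‖y - c‖ ∈ N} = 0 := by
  set M := toMeasurable volume N
  have hM : MeasurableSet M := measurableSet_toMeasurable _ _
  have hM0 : volume M = 0 := by rw [measure_toMeasurable, hN]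
  have hae : (fun r : ℝ ↦ r ^ (Module.finrank ℝ F - 1) • M.indicator (fun _ ↦ (1 : ℝ)) r)
      =ᵐ[volume.restrict (Ioi 0)] 0 := by
    refine ae_restrict_of_ae ?_
    filter_upwards [measure_eq_zero_iff_ae_notMem.1 hM0] with r hr
    simp [hr]
  -- Integrability must come first: a Bochner integral is also zero when the integrand is not
  -- integrable.
  have hint : Integrable (fun y : F ↦ M.indicator (fun _ ↦ (1 : ℝ)) ‖y‖) μ :=
    (integrable_fun_norm_addHaar μ).2 ((integrable_zero _ _ _).congr hae.symm)
  have hval := integral_fun_norm_addHaar μ (M.indicator fun _ ↦ (1 : ℝ))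
  rw [integral_congr_ae hae] at hval
  simp only [Pi.zero_apply, integral_zero, smul_zero] at hval
  rw [integral_eq_zero_iff_of_nonneg
    (fun y ↦ indicator_nonneg (fun _ _ ↦ zero_le_one) _) hint] at hval
  have h0 : μ {y : F | ‖y‖ ∈ M} = 0 := by
    refine measure_mono_null (fun y hy ↦ ?_) (ae_iff.1 hval)
    simpa using hy
  refine measure_mono_null (fun y hy ↦ ?_) ((measure_preimage_add_right μ (-c) _).trans h0)
  simpa [← sub_eq_add_neg] using subset_toMeasurable volume N hy

end AreaFormula

/-! ### Radial stretch -/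

namespace Poletsky

variable {n : ℕ}

/-- The factor `sup_{|h| = 1} |(f'(x)h, (f(x) - y₀)/|f(x) - y₀|)|`, as a function of `f'(x)` and of
the vector `f(x) - y₀`. -/
noncomputable def radialStretch (A : E n →L[ℝ] E n) (v : E n) : ℝ≥0∞ :=
  ⨆ h ∈ Metric.sphere (0 : E n) 1, ENNReal.ofReal |inner ℝ (A h) (‖v‖⁻¹ • v)|

theorem measurable_radialStretch {α : Type*} [MeasurableSpace α] {A : α → E n →L[ℝ] E n}
    {v : α → E n} (hA : Measurable A) (hv : Measurable v) :
    Measurable fun x ↦ radialStretch (A x) (v x) := by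
  have h0 (h : E n) : Continuous fun q : (E n →L[ℝ] E n) × E n ↦
      ENNReal.ofReal |inner ℝ (q.1 h) q.2| :=
    ENNReal.continuous_ofReal.comp
      ((continuous_fst.clm_apply continuous_const).inner continuous_snd).abs
  have h1 : Measurable fun q : (E n →L[ℝ] E n) × E n ↦
      ⨆ h ∈ Metric.sphere (0 : E n) 1, ENNReal.ofReal |inner ℝ (q.1 h) q.2| :=
    -- The supremum may be uncountable, but it is lower semicontinuous.
    (lowerSemicontinuous_biSup fun h _ ↦ (h0 h).lowerSemicontinuous).measurable
  have h2 : Measurable fun x ↦ (A x, ‖v x‖⁻¹ • v x) := hA.prodMk (hv.norm.inv.smul hv)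
  have h3 := h1.comp h2
  simpa only [Function.comp_def, radialStretch] using h3

theorem enorm_inner_le_radialStretch (A : E n →L[ℝ] E n) (v : E n) {w : E n} (hw : ‖w‖ ≤ 1) :
    ‖inner ℝ (A w) (‖v‖⁻¹ • v)‖ₑ ≤ radialStretch A v := by
  rcases eq_or_ne w 0 with rfl | hw0
  · simp
  have hpos : 0 < ‖w‖ := norm_pos_iff.2 hw0
  have hmem : ‖w‖⁻¹ • w ∈ Metric.sphere (0 : E n) 1 := by
    simp [norm_smul, hpos.ne']
  refine le_trans ?_ (le_iSup₂ (f := fun h (_ : h ∈ Metric.sphere (0 : E n) 1) ↦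
    ENNReal.ofReal |inner ℝ (A h) (‖v‖⁻¹ • v)|) _ hmem)
  rw [← ofReal_norm, Real.norm_eq_abs]
  refine ENNReal.ofReal_le_ofReal ?_
  rw [map_smul, inner_smul_left, abs_mul]
  refine le_mul_of_one_le_left (abs_nonneg _) ?_
  simpa using (one_le_inv₀ hpos).2 hw

end Poletsky

/-! ### Admissibility along curves, and the regular set -/

namespace Poletsky

variable {n : ℕ}

theorem enorm_deriv_norm_comp_sub_le {f : E n → E n} {g : ℝ → E n} {s : ℝ} {y₀ : E n}
    (hf : DifferentiableAt ℝ f (g s)) (hg : DifferentiableAt ℝ g s) (hg1 : ‖deriv g s‖ ≤ 1)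
    (hφ : DifferentiableAt ℝ (fun t ↦ ‖f (g t) - y₀‖) s) (hne : f (g s) ≠ y₀) :
    ‖deriv (fun t ↦ ‖f (g t) - y₀‖) s‖ₑ ≤
      radialStretch (fderiv ℝ f (g s)) (f (g s) - y₀) := by
  have hcomp : HasDerivAt (fun t ↦ f (g t) - y₀) (fderiv ℝ f (g s) (deriv g s)) s :=
    (hf.hasFDerivAt.comp_hasDerivAt s hg.hasDerivAt).sub_const y₀
  have hpos : 0 < ‖f (g s) - y₀‖ := norm_pos_iff.2 (sub_ne_zero.2 hne)
  have hderiv : deriv (fun t ↦ ‖f (g t) - y₀‖) s =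
      inner ℝ (fderiv ℝ f (g s) (deriv g s)) (‖f (g s) - y₀‖⁻¹ • (f (g s) - y₀)) := by
    -- The squared norm, differentiated in two ways.
    have h := hcomp.norm_sq.unique (hφ.hasDerivAt.pow 2)
    rw [inner_smul_right, real_inner_comm, inv_mul_eq_div, eq_div_iff hpos.ne']
    norm_num at h
    linarith
  rw [hderiv]
  exact enorm_inner_le_radialStretch _ _ hg1

theorem one_le_lineIntegral_of_mem_preimageCurves {D Z : Set (E n)} {f : E n → E n} {y₀ : E n}
    {r₁ r₂ : ℝ} (hr₁ : 0 < r₁) {η : ℝ → ℝ≥0∞} (hη : Measurable η)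
    (hη1 : 1 ≤ ∫⁻ r in Ioo r₁ r₂, η r) {ρ : E n → ℝ≥0∞} (hρ : Measurable ρ)
    (hZ : ∀ x ∈ Z, ρ x = ∞) (hdiff : ∀ x ∈ D, x ∉ Z → DifferentiableAt ℝ f x)
    (hle : ∀ x ∈ D, x ∉ Z → ‖f x - y₀‖ ∈ Ioo r₁ r₂ →
      η ‖f x - y₀‖ * radialStretch (fderiv ℝ f x) (f x - y₀) ≤ ρ x)
    {γ : Curve n} (hγ : γ ∈ preimageCurves D f y₀ r₁ r₂) (hAC : LocallyAbsContOn f γ) :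
    1 ≤ γ.lineIntegral ρ := by
  obtain ⟨hγD, β, ⟨a, b, hab, hβdom, hβa, hβb, -⟩, hdom, heq⟩ := hγ
  obtain ⟨hrect, hac⟩ := hAC
  have hγdom : γ.dom = Icc a b := hdom ▸ hβdom
  have ha : a ∈ γ.dom := hγdom ▸ left_mem_Icc.2 hab
  have hb : b ∈ γ.dom := hγdom ▸ right_mem_Icc.2 hab
  have hsub : Icc a b ⊆ γ.dom := hγdom.ge
  set g := γ.normalRep a b with hg
  set l := γ.length a b with hl
  have hl0 : 0 ≤ l := γ.length_nonneg a b
  have hlip : LipschitzOnWith 1 g (Icc 0 l) := γ.normalRep_lipschitzOnWith hrect hsub hab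
  have hgD : ∀ s ∈ Icc 0 l, g s ∈ D := fun s hs ↦ by
    obtain ⟨t, ht, hts⟩ := γ.normalRep_mapsTo hrect hsub hab hs
    rw [hg, ← hts]
    exact hγD t (hsub ht)
  set φ : ℝ → ℝ := fun t ↦ ‖f (g t) - y₀‖ with hφdef
  have hφ : AbsolutelyContinuousOnInterval φ 0 l := by
    have : LipschitzWith 1 fun v : E n ↦ ‖v - y₀‖ := by
      simpa only [dist_eq_norm] using LipschitzWith.dist_left y₀
    exact this.comp_absolutelyContinuousOnInterval (hac a ha b hb hab)
  have hφ0 : φ 0 = r₁ := by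
    rw [heq (hdom ▸ ha)] at hβa
    simpa [hφdef, hg, γ.normalRep_zero hrect ha hb hab, dist_eq_norm] using hβa
  have hφl : φ l = r₂ := by
    rw [heq (hdom ▸ hb)] at hβb
    simpa [hφdef, hg, hl, γ.normalRep_length hrect ha hb (right_mem_Icc.2 hab), dist_eq_norm]
      using hβb
  refine le_iSup₂_of_le a ha (le_iSup₂_of_le b hb (le_iSup_of_le hab ?_))
  -- If the integral is below 1, ρ is finite at almost every parameter, so the curve meets `Z` only
  -- on a null set of arc length.
  by_contra! hlt
  have hgm : AEMeasurable g (volume.restrict (Icc 0 l)) :=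
    hlip.continuousOn.aemeasurable measurableSet_Icc
  have hfin : ∀ᵐ s ∂volume.restrict (Icc 0 l), ρ (g s) < ∞ :=
    ae_lt_top' (hρ.comp_aemeasurable hgm) (hlt.trans ENNReal.one_lt_top).ne
  refine hlt.not_ge (hη1.trans ?_)
  have key := hφ.lintegral_Ioo_le hl0 hη
  rw [hφ0, hφl] at key
  refine key.trans (lintegral_mono_ae ?_)
  have hne0 : ∀ᵐ s : ℝ, s ≠ 0 := by simp [ae_iff, measure_singleton]
  have hnel : ∀ᵐ s : ℝ, s ≠ l := by simp [ae_iff, measure_singleton]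
  filter_upwards [hfin, ae_restrict_mem measurableSet_Icc,
    hlip.ae_differentiableWithinAt_real measurableSet_Icc,
    ae_restrict_of_ae hφ.ae_differentiableAt, ae_restrict_of_ae hne0, ae_restrict_of_ae hnel]
    with s hsfin hs hgs hφs hs0 hsl
  by_cases hmem : φ s ∈ Ioo r₁ r₂
  · rw [indicator_of_mem hmem]
    have hnhds : Icc 0 l ∈ 𝓝 s :=
      Icc_mem_nhds (lt_of_le_of_ne hs.1 hs0.symm) (lt_of_le_of_ne hs.2 hsl)
    have hsZ : g s ∉ Z := fun h ↦ hsfin.ne (hZ _ h)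
    have hne : f (g s) ≠ y₀ := by
      rw [← sub_ne_zero, ← norm_pos_iff]
      exact hr₁.trans hmem.1
    refine le_trans ?_ (hle (g s) (hgD s hs) hsZ hmem)
    gcongr
    refine enorm_deriv_norm_comp_sub_le (hdiff _ (hgD s hs) hsZ) (hgs.differentiableAt hnhds) ?_
      (hφs (by rwa [uIcc_of_le hl0])) hne
    simpa using norm_deriv_le_of_lipschitzOn hnhds hlip
  · rw [indicator_of_notMem hmem, zero_mul]
    exact zero_le

/-- The image of the critical set is null by Sard's theorem, so N⁻¹ makes the critical set itself
null. -/
theorem volume_sdiff_regular_eq_zero {D : Set (E n)} (hD : MeasurableSet D) {f : E n → E n}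
    (hf_diff : ∀ᵐ x ∂(volume.restrict D), DifferentiableAt ℝ f x) (hf_NInv : LuzinNInv D f) :
    volume (D \ {x | x ∈ D ∧ DifferentiableAt ℝ f x ∧ (fderiv ℝ f x).det ≠ 0}) = 0 := by
  set C := {x | x ∈ D ∧ DifferentiableAt ℝ f x ∧ (fderiv ℝ f x).det = 0} with hC
  have hfC : volume (f '' C) = 0 :=
    addHaar_image_eq_zero_of_det_fderivWithin_eq_zero volume
      (fun x hx ↦ hx.2.1.hasFDerivAt.hasFDerivWithinAt) fun x hx ↦ hx.2.2
  have hC0 : volume C = 0 :=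
    measure_mono_null (show C ⊆ D ∩ f ⁻¹' (f '' C) from fun x hx ↦
      ⟨hx.1, mem_image_of_mem f hx⟩) (hf_NInv _ hfC)
  have hN0 : volume {x | ¬(x ∈ D → DifferentiableAt ℝ f x)} = 0 :=
    ae_iff.1 ((ae_restrict_iff' hD).1 hf_diff)
  refine measure_mono_null (fun x hx ↦ ?_) (measure_union_null hC0 hN0)
  by_cases hd : DifferentiableAt ℝ f x
  · refine Or.inl ⟨hx.1, hd, ?_⟩
    by_contra h0
    exact hx.2 ⟨hx.1, hd, h0⟩
  · exact Or.inr fun h ↦ hd (h hx.1)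

end Poletsky

/-! ### The inverse Poletsky inequality -/

open Poletsky in
theorem mainTheorem1 (n : ℕ) (hn : 2 ≤ n) (p : ℝ) (hp : 1 < p)
    (D : Set (Poletsky.E n)) (hD_open : IsOpen D) (hD_conn : IsConnected D)
    (f : Poletsky.E n → Poletsky.E n)
    (hf_diff : ∀ᵐ x ∂(volume.restrict D), DifferentiableAt ℝ f x)
    (hf_N : Poletsky.LuzinN D f) (hf_NInv : Poletsky.LuzinNInv D f)
    (hf_ACP : Poletsky.ACP p D f)
    (y₀ : Poletsky.E n) (hy₀ : y₀ ∈ closure (f '' D)) :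
    Poletsky.InversePoletsky p D f y₀ (Poletsky.cotangentDilatation p D f y₀) := by
  have hp0 : 0 < p := zero_lt_one.trans hp
  have hnt : Nontrivial (E n) := by
    refine Module.nontrivial_of_finrank_pos (R := ℝ) ?_
    rw [finrank_euclideanSpace_fin]
    omega
  set B := {x | x ∈ D ∧ DifferentiableAt ℝ f x ∧ (fderiv ℝ f x).det ≠ 0} with hB
  have hdetm : Measurable fun x ↦ (fderiv ℝ f x).det :=
    ContinuousLinearMap.continuous_det.measurable.comp (measurable_fderiv ℝ f)
  have hBm : MeasurableSet B :=
    hD_open.measurableSet.inter ((measurableSet_of_differentiableAt ℝ f).inter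
      (hdetm (measurableSet_singleton 0).compl))
  have hB0 : volume (D \ B) = 0 :=
    volume_sdiff_regular_eq_zero hD_open.measurableSet hf_diff hf_NInv
  have hfB : ∀ x ∈ B, HasFDerivWithinAt f (fderiv ℝ f x) B x := fun x hx ↦
    hx.2.1.hasFDerivAt.hasFDerivWithinAt
  have hdet : ∀ x ∈ B, (fderiv ℝ f x).det ≠ 0 := fun x hx ↦ hx.2.2
  -- `f` need not be Borel; it is replaced by a Borel map that agrees with it on `B`.
  obtain ⟨F, hFm, hFf⟩ : ∃ F : E n → E n, Measurable F ∧ EqOn F f B := by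
    classical
    refine ⟨B.piecewise f 0, ?_, B.piecewise_eqOn f 0⟩
    exact ContinuousOn.measurable_piecewise (fun x hx ↦ (hfB x hx).continuousWithinAt)
      continuousOn_const hBm
  set S : E n → ℝ≥0∞ := fun x ↦ radialStretch (fderiv ℝ f x) (F x - y₀) with hS
  set J : E n → ℝ≥0∞ := fun x ↦ ENNReal.ofReal |(fderiv ℝ f x).det| with hJ
  have hSm : Measurable S :=
    measurable_radialStretch (measurable_fderiv ℝ f) (hFm.sub_const y₀)
  have hJm : Measurable J := hdetm.abs.ennreal_ofReal
  have hgm : Measurable fun x ↦ S x ^ p / J x := (hSm.pow_const p).div hJm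
  have hQ : ∀ y, cotangentDilatation p D f y₀ y = ∑' x : ↥{x | x ∈ D ∧ f x = y},
      radialStretch (fderiv ℝ f x) (f x - y₀) ^ p / J x := fun y ↦ rfl
  have hterm : ∀ y, ∑' x : ↥(B ∩ f ⁻¹' {y}), S x ^ p / J x =
      ∑' x : ↥(B ∩ f ⁻¹' {y}), radialStretch (fderiv ℝ f x) (f x - y₀) ^ p / J x := fun y ↦
    tsum_congr fun x ↦ by simp only [hS, hFf x.2.1]
  refine ⟨?_, fun r₁ r₂ hr₁ hr₁₂ _ η hη hη1 ↦ ?_⟩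
  · refine ⟨_, (measurable_tsum_preimage_and_lintegral_eq volume hBm hfB hdet hgm).1, ?_⟩
    -- By N, almost every `y` has no preimage in `D \ B`.
    filter_upwards [measure_eq_zero_iff_ae_notMem.1 (hf_N _ sdiff_subset hB0)] with y hy
    rw [hQ, hterm]
    have hset : {x | x ∈ D ∧ f x = y} = B ∩ f ⁻¹' {y} := by
      ext x
      refine ⟨fun hx ↦ ⟨?_, hx.2⟩, fun hx ↦ ⟨hx.1.1, hx.2⟩⟩
      by_contra hxB
      exact hy ⟨x, ⟨hx.1, hxB⟩, hx.2⟩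
    rw [hset]
  obtain ⟨Γ₀, hΓ₀, hACP⟩ := hf_ACP
  set η' := hη.mk η with hη'
  have hη'm : Measurable η' := hη.measurable_mk
  have hη'1 : 1 ≤ ∫⁻ r in Ioo r₁ r₂, η' r := hη1.trans_eq (lintegral_congr_ae hη.ae_eq_mk)
  set θ : E n → ℝ≥0∞ := fun x ↦ (Ioo r₁ r₂).indicator η' ‖F x - y₀‖ with hθ
  have hθm : Measurable θ :=
    (hη'm.indicator measurableSet_Ioo).comp (hFm.sub_const y₀).norm
  set Z := toMeasurable volume (D \ B) with hZ
  have hZm : MeasurableSet Z := measurableSet_toMeasurable _ _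
  have hZ0 : volume Z = 0 := by rw [hZ, measure_toMeasurable, hB0]
  have hDZ : ∀ x ∈ D, x ∉ Z → x ∈ B := fun x hx hxZ ↦ by
    by_contra hxB
    exact hxZ (subset_toMeasurable _ _ ⟨hx, hxB⟩)
  classical
  set ρ : E n → ℝ≥0∞ := Z.piecewise (fun _ ↦ ∞) (B.indicator fun x ↦ θ x * S x) with hρ
  have hρm : Measurable ρ := measurable_const.piecewise hZm ((hθm.mul hSm).indicator hBm)
  have hmod : modulus p (preimageCurves D f y₀ r₁ r₂) ≤ ∫⁻ x, ρ x ^ p := by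
    refine (modulus_le_add (Γ₀ := Γ₀) hρm fun γ hγ hγ0 _ ↦ ?_).trans_eq (by rw [hΓ₀, add_zero])
    refine one_le_lineIntegral_of_mem_preimageCurves hr₁ hη'm hη'1 hρm
      (fun x hx ↦ piecewise_eq_of_mem _ _ _ hx) (fun x hx hxZ ↦ (hDZ x hx hxZ).2.1)
      (fun x hx hxZ hmem ↦ ?_) hγ (hACP γ hγ.1 hγ0)
    have hxB := hDZ x hx hxZ
    rw [hρ, piecewise_eq_of_notMem _ _ _ hxZ, indicator_of_mem hxB]
    simp only [hθ, hS, hFf hxB, indicator_of_mem hmem, le_refl]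
  refine hmod.trans ?_
  set W : E n → ℝ≥0∞ := fun y ↦ ∑' x : ↥(B ∩ f ⁻¹' {y}), θ x ^ p * (S x ^ p / J x) with hW
  have hWeq : ∀ y, W y = (Ioo r₁ r₂).indicator η' ‖y - y₀‖ ^ p *
      ∑' x : ↥(B ∩ f ⁻¹' {y}), S x ^ p / J x := fun y ↦ by
    rw [hW, ← ENNReal.tsum_mul_left]
    refine tsum_congr fun x ↦ ?_
    have hxy : f x = y := x.2.2
    simp only [hθ, hFf x.2.1, hxy]
  have hhm : Measurable fun x ↦ θ x ^ p * (S x ^ p / J x) := (hθm.pow_const p).mul hgm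
  have hint : ∫⁻ x, ρ x ^ p = ∫⁻ y, W y := by
    rw [(measurable_tsum_preimage_and_lintegral_eq volume hBm hfB hdet hhm).2,
      ← lintegral_indicator hBm]
    refine lintegral_congr_ae ?_
    filter_upwards [measure_eq_zero_iff_ae_notMem.1 hZ0] with x hxZ
    rw [hρ, piecewise_eq_of_notMem _ _ _ hxZ]
    by_cases hxB : x ∈ B
    -- The Jacobian from the area formula cancels the denominator, as it is neither 0 nor ∞ on `B`.
    · have hJ0 : J x ≠ 0 := by
        simpa [hJ] using hdet x hxB
      rw [indicator_of_mem hxB, indicator_of_mem hxB, ENNReal.mul_rpow_of_nonneg _ _ hp0.le,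
        mul_left_comm, ENNReal.mul_div_cancel hJ0 ENNReal.ofReal_ne_top]
    · rw [indicator_of_notMem hxB, indicator_of_notMem hxB, ENNReal.zero_rpow_of_pos hp0]
  have hsupp : Function.support W ⊆ sphericalRing y₀ r₁ r₂ ∩ f '' D := by
    intro y hy
    rw [Function.mem_support, hWeq] at hy
    refine ⟨?_, ?_⟩
    · by_contra hyA
      refine hy ?_
      rw [indicator_of_notMem (show ‖y - y₀‖ ∉ Ioo r₁ r₂ from hyA),
        ENNReal.zero_rpow_of_pos hp0, zero_mul]
    · by_contra hyD
      refine hy ?_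
      have : B ∩ f ⁻¹' {y} = ∅ :=
        eq_empty_of_forall_notMem fun x hx ↦ hyD ⟨x, hx.1.1, hx.2⟩
      rw [this]
      simp
  rw [hint, ← setLIntegral_eq_of_support_subset hsupp]
  have hnull := measure_norm_sub_mem_eq_zero volume
    (ae_iff.1 ((ae_restrict_iff' measurableSet_Ioo).1 hη.ae_eq_mk)) y₀
  refine lintegral_mono_ae (ae_restrict_of_ae ?_)
  filter_upwards [measure_eq_zero_iff_ae_notMem.1 hnull] with y hy
  rw [hWeq, mul_comm]
  by_cases hyA : ‖y - y₀‖ ∈ Ioo r₁ r₂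
  · have hηy : η ‖y - y₀‖ = η' ‖y - y₀‖ := not_not.1 hy hyA
    rw [indicator_of_mem hyA, hηy, hQ, hterm]
    -- Only the inequality between the fibre sums over `B` and over `D` is needed here.
    gcongr
    exact ENNReal.tsum_mono_subtype
      (fun x ↦ radialStretch (fderiv ℝ f x) (f x - y₀) ^ p / J x) fun x hx ↦ ⟨hx.1.1, hx.2⟩
  · rw [indicator_of_notMem hyA, ENNReal.zero_rpow_of_pos hp0, mul_zero]
    exact zero_le
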